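/- Let $\mathbb L=\{u+jv : u,v\in\mathbb R\}$, $j^2=1$, be the algebra of Lorentz (para-complex) numbers with the topology of $\mathbb R^2$. A function $f:\mathbb L\to\mathbb L$ is called $\mathbb L$-analytic if around every $z_0\in\mathbb L$ it is given by a convergent power series $f(z)=\sum_{n\ge 0} a_n(z-z_0)^n$ with $a_n\in\mathbb L$, and $f'(z)$ denotes the para-complex derivative, characterized by $f(w)=f(z)+f'(z)(w-z)+o(|w-z|)$ as $w\to z$. Let $p$ be a real or imaginary modulus with $p^2\in\mathbb R\setminus\{0,1\}$, let $q^2=1-p^2$, and let $\mathrm{sn}_p,\mathrm{cn}_p,\mathrm{dn}_p:\mathbb R\to\mathbb R$ be the Jacobi elliptic functions. For $p^2<1$ these are $\sin\circ\,\mathrm{am}_p$, $\cos\circ\,\mathrm{am}_p$ and $\sqrt{1-p^2\,\mathrm{sn}_p^2}$, where the amplitude $\mathrm{am}_p$ is the inverse of $\varphi\mapsto\int_0^\varphi d\theta/\sqrt{1-p^2\sin^2\theta}$, and $K_p=\int_0^{\pi/2}d\theta/\sqrt{1-p^2\sin^2\theta}$. For $p>1$ they are $\mathrm{sn}_p x=\frac1p\mathrm{sn}_{1/p}(px)$,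 $\mathrm{cn}_p x=\mathrm{dn}_{1/p}(px)$, $\mathrm{dn}_p x=\mathrm{cn}_{1/p}(px)$. (i) Each of $\mathrm{sn}_p,\mathrm{cn}_p,\mathrm{dn}_p$ has a unique $\mathbb L$-analytic extension $\mathbb L\to\mathbb L$, denoted by the same symbol. (ii) The extensions are para-complex differentiable everywhere and satisfy on $\mathbb L$ the same elliptic differential equations as the real functions: $$(\mathrm{sn}_p')^2=(1-\mathrm{sn}_p^2)(1-p^2\mathrm{sn}_p^2),\quad (\mathrm{cn}_p')^2=(1-\mathrm{cn}_p^2)(q^2+p^2\mathrm{cn}_p^2),\quad (\mathrm{dn}_p')^2=(\mathrm{dn}_p^2-1)(q^2-\mathrm{dn}_p^2).$$ (iii) The extensions are doubly periodic. For $\kappa>0$ let $\Lambda_\kappa$ be the lattice spanned by $\kappa(1+j)$ and $\kappa(1-j)$, that is, $\Lambda_\kappa=\{u+jv : u\pm v\in 2\kappa\mathbb Z\}$, and let $D_\kappa=\{u+jv : -\kappa\le u\pm v\le\kappa\}$. A set is a fundamental domain of a lattice if it is the closure of its interior, its translates by the lattice cover $\mathbb L$, and distinct translates have disjoint interiors.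 If $p^2<1$, then the group of all periods of $\mathrm{sn}_p$ and that of $\mathrm{cn}_p$ is $\Lambda_{2K_p}$, while that of $\mathrm{dn}_p$ is $\Lambda_{K_p}\supset\Lambda_{2K_p}$; in particular all three are periodic with respect to $\Lambda_{2K_p}$. The square $D_{2K_p}=\{u+jv : -2K_p\le u\pm v\le 2K_p\}$ is a fundamental domain of $\Lambda_{2K_p}$, and $D_{K_p}$ is one of $\Lambda_{K_p}$. If $p>1$, the same holds with $K_p$ replaced by $K_{1/p}/p$ and with the roles of $\mathrm{cn}_p$ and $\mathrm{dn}_p$ interchanged. -/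

import Mathlib

namespace LJacobi

open Topology

/-- The algebra of Lorentz (para-complex) numbers `u + j v` with real `u, v` and `j ^ 2 = 1`;
`⟨u, v⟩` stands for `u + j v`. -/
abbrev Lorentz : Type := QuadraticAlgebra ℝ 1 0

/-- The real-linear identification of `u + j v` with the point `(u, v)` of the plane. -/
def toPlane : Lorentz →ₗ[ℝ] ℝ × ℝ where
  toFun z := (z.re, z.im)
  map_add' _ _ := rfl
  map_smul' _ _ := rfl

theorem toPlane_injective : Function.Injective toPlane := by
  intro z w h
  exact QuadraticAlgebra.ext (congrArg Prod.fst h) (congrArg Prod.snd h)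

/-- The usual topology of the plane, given by the norm `max |u| |v|` of `u + j v`
(not by the indefinite modulus `u ^ 2 - v ^ 2`). -/
noncomputable instance : NormedAddCommGroup Lorentz :=
  NormedAddCommGroup.induced Lorentz (ℝ × ℝ) toPlane toPlane_injective

noncomputable instance : NormedSpace ℝ Lorentz :=
  NormedSpace.induced ℝ Lorentz (ℝ × ℝ) toPlane

/-- The incomplete elliptic integral of the first kind with parameter `m` (`m = p ^ 2` for the
modulus `p`), as a function of the amplitude. -/
noncomputable def ellipticF (m φ : ℝ) : ℝ :=
  ∫ θ in (0 : ℝ)..φ, 1 / √(1 - m * Real.sin θ ^ 2)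

/-- The complete elliptic integral of the first kind. -/
noncomputable def ellipticK (m : ℝ) : ℝ := ellipticF m (Real.pi / 2)

/-- The Jacobi amplitude function: for `m < 1` the inverse of the increasing bijection
`ellipticF m` of the real line. -/
noncomputable def jacobiAm (m : ℝ) : ℝ → ℝ := Function.invFun (ellipticF m)

/-- The real function `sn` with parameter `m = p ^ 2`: through the amplitude for `m < 1` (real
modulus `|p| < 1`, or imaginary modulus), and by the reciprocal modulus transformation
`sn_p x = sn_{1/p} (p x) / p` for `m > 1`. (The parameter `m = 1` is never used.) -/
noncomputable def jacobiSn (m x : ℝ) : ℝ :=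
  if m < 1 then Real.sin (jacobiAm m x)
  else Real.sin (jacobiAm m⁻¹ (√m * x)) / √m

/-- The real function `cn` with parameter `m = p ^ 2`; `cn_p x = dn_{1/p} (p x)` for `m > 1`. -/
noncomputable def jacobiCn (m x : ℝ) : ℝ :=
  if m < 1 then Real.cos (jacobiAm m x)
  else √(1 - m⁻¹ * Real.sin (jacobiAm m⁻¹ (√m * x)) ^ 2)

/-- The real function `dn` with parameter `m = p ^ 2`; `dn_p x = cn_{1/p} (p x)` for `m > 1`. -/
noncomputable def jacobiDn (m x : ℝ) : ℝ :=
  if m < 1 then √(1 - m * Real.sin (jacobiAm m x) ^ 2)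
  else Real.cos (jacobiAm m⁻¹ (√m * x))

/-- `f` is Lorentz-analytic on the whole algebra: around every point it is given by a power
series with Lorentz number coefficients. -/
def IsLAnalytic (f : Lorentz → Lorentz) : Prop :=
  ∀ z₀ : Lorentz, ∃ a : ℕ → Lorentz, ∀ᶠ z in 𝓝 z₀, HasSum (fun n => a n * (z - z₀) ^ n) (f z)

/-- `f` is a Lorentz-analytic extension of the real function `y`. -/
def IsLAnalyticExtension (y : ℝ → ℝ) (f : Lorentz → Lorentz) : Prop :=
  IsLAnalytic f ∧ ∀ x : ℝ, f (algebraMap ℝ Lorentz x) = algebraMap ℝ Lorentz (y x)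

/-- `f` is the one and only Lorentz-analytic extension of `y`. -/
def IsUniqueLAnalyticExtension (y : ℝ → ℝ) (f : Lorentz → Lorentz) : Prop :=
  IsLAnalyticExtension y f ∧ ∀ g, IsLAnalyticExtension y g → g = f

/-- `f` is para-complex differentiable at `z` with para-complex derivative `d`: it is (Fréchet)
differentiable and its differential is multiplication by `d`. -/
def HasLDerivAt (f : Lorentz → Lorentz) (d z : Lorentz) : Prop :=
  (fun w => f w - f z - d * (w - z)) =o[𝓝 z] fun w => w - z

/-- The group of all periods of `f`. -/
def periods (f : Lorentz → Lorentz) : AddSubgroup Lorentz where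
  carrier := {w | ∀ z, f (z + w) = f z}
  zero_mem' z := by rw [add_zero]
  add_mem' {a b} ha hb z := by rw [← add_assoc, hb, ha]
  neg_mem' {a} ha z := by rw [← ha (z + -a), neg_add_cancel_right]

/-- `f` is doubly periodic, with its group of periods spanned by `w₁` and `w₂`, which are
linearly independent over the reals. -/
def HasPeriodLattice (f : Lorentz → Lorentz) (w₁ w₂ : Lorentz) : Prop :=
  LinearIndependent ℝ ![w₁, w₂] ∧ periods f = AddSubgroup.closure {w₁, w₂}

/-- `D` is a fundamental domain for the translation group `Λ`: it is the closure of its interior,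
its translates cover everything, and distinct translates have disjoint interiors. -/
def IsFundamentalDomain (Λ : AddSubgroup Lorentz) (D : Set Lorentz) : Prop :=
  closure (interior D) = D ∧
  (∀ z, ∃ w ∈ Λ, z + w ∈ D) ∧
  ∀ w ∈ Λ, w ≠ 0 → ∀ z ∈ interior D, z + w ∉ interior D

/-- The Lorentz number `r (1 + j)`. -/
def nullPlus (r : ℝ) : Lorentz := ⟨r, r⟩

/-- The Lorentz number `r (1 - j)`. -/
def nullMinus (r : ℝ) : Lorentz := ⟨r, -r⟩

/-- The group spanned by `r (1 + j)` and `r (1 - j)`, that is, the group of all `u + j v` for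
which `u + v` and `u - v` are integer multiples of `2 r`. -/
def nullLattice (r : ℝ) : AddSubgroup Lorentz :=
  AddSubgroup.closure {nullPlus r, nullMinus r}

/-- The square `{u + j v | -r ≤ u ± v ≤ r}`. -/
def nullSquare (r : ℝ) : Set Lorentz :=
  {z | -r ≤ z.re + z.im ∧ z.re + z.im ≤ r ∧ -r ≤ z.re - z.im ∧ z.re - z.im ≤ r}

end LJacobi

namespace LJacobi

open Topology Asymptotics Filter

/-! The null coordinates `u + v` and `u - v` turn the Lorentz numbers into the product algebra `ℝ ×
ℝ`. Each coordinate of an L-analytic function depends only on the same coordinate of its argument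
(`IsLAnalytic.apply_eq_of_apply_eq`). An extension of `y` is known on the diagonal, so it must apply
`y` to both coordinates. Derivatives and polynomial identities can then be checked coordinatewise,
and a Lorentz number is a period exactly when both its coordinates are periods of `y`. If the real
period group is `2rℤ`, the Lorentz one is `nullLattice r` (`periods_nullExtension`).

What remains is real. For `m < 1` the elliptic integral is analytic with positive derivative, so the
amplitude is analytic (`analyticAt_jacobiAm`). Advancing the argument by `2K` adds `π` to the
amplitude (`jacobiAm_add_int_mul`), which gives the exact period groups. The case `m > 1` follows by
rescaling from `m⁻¹`. -/

/-! ### Null coordinates and the unique analytic extension. -/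

/-- The null coordinates `(u + v, u - v)` of `u + j v`, an isomorphism of the algebra of Lorentz
numbers with `ℝ × ℝ`. -/
noncomputable def nullCoord : Lorentz ≃ₐ[ℝ] ℝ × ℝ where
  toFun z := (z.re + z.im, z.re - z.im)
  invFun x := ⟨(x.1 + x.2) / 2, (x.1 - x.2) / 2⟩
  left_inv z := by ext <;> simp
  right_inv x := by ext <;> simp <;> ring
  map_mul' z w := by ext <;> simp <;> ring
  map_add' z w := by ext <;> simp <;> ring
  commutes' r := by ext <;> simp [QuadraticAlgebra.algebraMap_eq]

theorem nullCoord_apply (z : Lorentz) : nullCoord z = (z.re + z.im, z.re - z.im) := rfl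

/-- The null coordinates as a homeomorphism with the plane. -/
noncomputable def nullCoordL : Lorentz ≃L[ℝ] ℝ × ℝ :=
  nullCoord.toLinearEquiv.toContinuousLinearEquiv

theorem nullCoordL_apply (z : Lorentz) : nullCoordL z = nullCoord z := rfl

theorem nullCoordL_symm_apply (x : ℝ × ℝ) : nullCoordL.symm x = nullCoord.symm x := rfl

theorem continuous_nullCoord : Continuous nullCoord := nullCoordL.continuous

/-- The function whose null coordinates are `y` of the null coordinates of the argument. -/
noncomputable def nullExtension (y : ℝ → ℝ) (z : Lorentz) : Lorentz :=
  nullCoord.symm (y (nullCoord z).1, y (nullCoord z).2)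

theorem nullCoord_nullExtension (y : ℝ → ℝ) (z : Lorentz) :
    nullCoord (nullExtension y z) = (y (nullCoord z).1, y (nullCoord z).2) :=
  nullCoord.apply_symm_apply _

theorem isLAnalytic_nullExtension {y : ℝ → ℝ} (hy : ∀ x, AnalyticAt ℝ y x) :
    IsLAnalytic (nullExtension y) := by
  intro z₀
  obtain ⟨p, hp⟩ := hy (nullCoord z₀).1
  obtain ⟨q, hq⟩ := hy (nullCoord z₀).2
  rw [hasFPowerSeriesAt_iff'] at hp hq
  refine ⟨fun n => nullCoord.symm (p.coeff n, q.coeff n), ?_⟩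
  have h₁ : Tendsto (fun z => (nullCoord z).1) (𝓝 z₀) (𝓝 (nullCoord z₀).1) :=
    (continuous_fst.comp continuous_nullCoord).tendsto z₀
  have h₂ : Tendsto (fun z => (nullCoord z).2) (𝓝 z₀) (𝓝 (nullCoord z₀).2) :=
    (continuous_snd.comp continuous_nullCoord).tendsto z₀
  filter_upwards [h₁.eventually hp, h₂.eventually hq] with z hz₁ hz₂
  have h := (hz₁.prodMk hz₂).map nullCoordL.symm nullCoordL.symm.continuous
  convert h using 1
  · funext n
    apply nullCoord.injective
    ext <;> simp [nullCoordL_symm_apply, mul_comm]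
  · rfl

/-- Applied to a power series, the character `π` gives a real series in `π z - π z₀`. Hence `π ∘ g`
is locally constant along fibres of `π`, and the segment joining `z` to `w` stays in one fibre. -/
theorem IsLAnalytic.apply_eq_of_apply_eq {g : Lorentz → Lorentz} (hg : IsLAnalytic g)
    (π : Lorentz →ₐ[ℝ] ℝ) {z w : Lorentz} (h : π z = π w) : π (g z) = π (g w) := by
  have hπ : Continuous π := π.toLinearMap.continuous_of_finiteDimensional
  have hloc : ∀ z₀, ∀ᶠ z in 𝓝 z₀, π z = π z₀ → π (g z) = π (g z₀) := by
    intro z₀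
    obtain ⟨a, ha⟩ := hg z₀
    have h₀ := ha.self_of_nhds.map π hπ
    filter_upwards [ha] with z hz hzz
    refine (hz.map π hπ).unique ?_
    convert h₀ using 1
    funext n
    simp [hzz]
  have hlc : IsLocallyConstant fun t : ℝ => π (g (z + t • (w - z))) := by
    rw [IsLocallyConstant.iff_eventually_eq]
    intro t
    have hc : Continuous fun t : ℝ => z + t • (w - z) := by fun_prop
    filter_upwards [(hc.tendsto t).eventually (hloc _)] with s hs
    exact hs (by simp [h])
  simpa using hlc.apply_eq_of_isPreconnected isPreconnected_univ (Set.mem_univ 0) (Set.mem_univ 1)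

theorem isUniqueLAnalyticExtension_nullExtension {y : ℝ → ℝ} (hy : ∀ x, AnalyticAt ℝ y x) :
    IsUniqueLAnalyticExtension y (nullExtension y) := by
  refine ⟨⟨isLAnalytic_nullExtension hy, fun x => nullCoord.injective ?_⟩, ?_⟩
  · simp [nullCoord_nullExtension]
  · rintro g ⟨hg, hgy⟩
    funext z
    apply nullCoord.injective
    rw [nullCoord_nullExtension]
    have key (π : Lorentz →ₐ[ℝ] ℝ) : π (g z) = y (π z) := by
      -- The real number `π z` lies in the same fibre of `π` as `z`, and there `g` is known.
      rw [hg.apply_eq_of_apply_eq π (w := algebraMap ℝ Lorentz (π z)) (by simp), hgy]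
      simp
    exact Prod.ext (key ((AlgHom.fst ℝ ℝ ℝ).comp nullCoord.toAlgHom))
      (key ((AlgHom.snd ℝ ℝ ℝ).comp nullCoord.toAlgHom))

theorem hasLDerivAt_nullExtension {y : ℝ → ℝ} {z : Lorentz} {d : ℝ × ℝ}
    (h₁ : HasDerivAt y d.1 (nullCoord z).1) (h₂ : HasDerivAt y d.2 (nullCoord z).2) :
    HasLDerivAt (nullExtension y) (nullCoord.symm d) z := by
  have hO : (fun w => nullCoordL (w - z)) =O[𝓝 z] fun w => w - z :=
    nullCoordL.toContinuousLinearMap.isBigO_comp _ _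
  have hc₁ : Tendsto (fun z => (nullCoord z).1) (𝓝 z) (𝓝 (nullCoord z).1) :=
    (continuous_fst.comp continuous_nullCoord).tendsto z
  have hc₂ : Tendsto (fun z => (nullCoord z).2) (𝓝 z) (𝓝 (nullCoord z).2) :=
    (continuous_snd.comp continuous_nullCoord).tendsto z
  -- Each real remainder is little-o of its own coordinate of `w - z`, which is in turn big-O of `w
  -- - z`.
  have l₁ := (h₁.isLittleO.comp_tendsto hc₁).trans_isBigO
    ((isBigO_fst_prod' (f' := fun w => nullCoordL (w - z))).trans hO |>.congr_left fun w => by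
      simp [nullCoordL_apply])
  have l₂ := (h₂.isLittleO.comp_tendsto hc₂).trans_isBigO
    ((isBigO_snd_prod' (f' := fun w => nullCoordL (w - z))).trans hO |>.congr_left fun w => by
      simp [nullCoordL_apply])
  refine ((nullCoordL.symm.toContinuousLinearMap.isBigO_comp _ _).trans_isLittleO
    (l₁.prod_left l₂)).congr_left fun w => ?_
  apply nullCoordL.injective
  simp only [Function.comp_apply, smul_eq_mul, ContinuousLinearEquiv.coe_coe,
    ContinuousLinearEquiv.apply_symm_apply, nullCoordL_apply, map_sub, map_mul,
    nullCoord_nullExtension, AlgEquiv.apply_symm_apply]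
  ext <;> simp [mul_comm]

theorem exists_hasLDerivAt_nullExtension {y : ℝ → ℝ} {P : ℝ → ℝ} {Q : Lorentz → Lorentz}
    (hPQ : ∀ z, nullCoord (Q z) = (P (nullCoord z).1, P (nullCoord z).2))
    (hy : ∀ x, ∃ d, HasDerivAt y d x ∧ d ^ 2 = P (y x)) (z : Lorentz) :
    ∃ d, HasLDerivAt (nullExtension y) d z ∧ d ^ 2 = Q (nullExtension y z) := by
  obtain ⟨d₁, h₁, e₁⟩ := hy (nullCoord z).1
  obtain ⟨d₂, h₂, e₂⟩ := hy (nullCoord z).2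
  refine ⟨nullCoord.symm (d₁, d₂), hasLDerivAt_nullExtension h₁ h₂, nullCoord.injective ?_⟩
  rw [hPQ, nullCoord_nullExtension, map_pow, AlgEquiv.apply_symm_apply, Prod.pow_mk, e₁, e₂]

/-! ### Period lattices. -/

theorem mem_nullLattice {r : ℝ} {w : Lorentz} : w ∈ nullLattice r ↔
    (∃ n : ℤ, (nullCoord w).1 = n * (2 * r)) ∧ ∃ n : ℤ, (nullCoord w).2 = n * (2 * r) := by
  have key (a b : ℤ) : nullCoord (a • nullPlus r + b • nullMinus r) =
      (a * (2 * r), b * (2 * r)) := by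
    rw [map_add, map_zsmul, map_zsmul]
    ext <;> simp [nullCoord_apply, nullPlus, nullMinus] <;> ring
  rw [nullLattice, AddSubgroup.mem_closure_pair]
  constructor
  · rintro ⟨a, b, rfl⟩
    rw [key]
    exact ⟨⟨a, rfl⟩, b, rfl⟩
  · rintro ⟨⟨a, ha⟩, b, hb⟩
    exact ⟨a, b, nullCoord.injective (by rw [key, ← ha, ← hb])⟩

theorem mem_periods_nullExtension {y : ℝ → ℝ} {w : Lorentz} :
    w ∈ periods (nullExtension y) ↔
      Function.Periodic y (nullCoord w).1 ∧ Function.Periodic y (nullCoord w).2 := by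
  change (∀ z, nullExtension y (z + w) = nullExtension y z) ↔ _
  simp only [← nullCoord.injective.eq_iff (a := nullExtension y _), nullCoord_nullExtension,
    map_add, Prod.mk.injEq, Prod.fst_add, Prod.snd_add]
  refine ⟨fun h => ⟨fun x => ?_, fun x => ?_⟩, fun h z => ⟨h.1 _, h.2 _⟩⟩
  -- The two coordinates vary independently, so each can be tested with the other set to zero.
  · simpa using (h (nullCoord.symm (x, 0))).1
  · simpa using (h (nullCoord.symm (0, x))).2

theorem periods_nullExtension {y : ℝ → ℝ} {r : ℝ}
    (hy : ∀ c, Function.Periodic y c ↔ ∃ n : ℤ, c = n * (2 * r)) :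
    periods (nullExtension y) = nullLattice r := by
  ext w
  rw [mem_periods_nullExtension, hy, hy, mem_nullLattice]

theorem linearIndependent_nullPlus_nullMinus {r : ℝ} (hr : r ≠ 0) :
    LinearIndependent ℝ ![nullPlus r, nullMinus r] := by
  rw [LinearIndependent.pair_iff]
  intro s t h
  have h₁ := congrArg QuadraticAlgebra.re h
  have h₂ := congrArg QuadraticAlgebra.im h
  simp only [nullPlus, nullMinus, QuadraticAlgebra.re_add, QuadraticAlgebra.im_add,
    QuadraticAlgebra.re_smul, QuadraticAlgebra.im_smul, QuadraticAlgebra.re_zero,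
    QuadraticAlgebra.im_zero, smul_eq_mul] at h₁ h₂
  constructor <;> apply mul_right_cancel₀ hr <;> linarith

theorem hasPeriodLattice_nullExtension {y : ℝ → ℝ} {r : ℝ} (hr : r ≠ 0)
    (hy : ∀ c, Function.Periodic y c ↔ ∃ n : ℤ, c = n * (2 * r)) :
    HasPeriodLattice (nullExtension y) (nullPlus r) (nullMinus r) :=
  ⟨linearIndependent_nullPlus_nullMinus hr, periods_nullExtension hy⟩

theorem nullLattice_two_mul_le (r : ℝ) : nullLattice (2 * r) ≤ nullLattice r := by
  intro w hw
  rw [mem_nullLattice] at hw ⊢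
  obtain ⟨⟨a, ha⟩, b, hb⟩ := hw
  exact ⟨⟨2 * a, by rw [ha]; push_cast; ring⟩, 2 * b, by rw [hb]; push_cast; ring⟩

/-! ### Fundamental domains. -/

theorem nullSquare_eq_preimage (r : ℝ) :
    nullSquare r = nullCoordL.toHomeomorph ⁻¹' (Set.Icc (-r) r ×ˢ Set.Icc (-r) r) := by
  ext z
  change _ ↔ nullCoord z ∈ Set.Icc (-r) r ×ˢ Set.Icc (-r) r
  rw [nullCoord_apply, Set.mem_prod, Set.mem_Icc, Set.mem_Icc, and_assoc]
  rfl

theorem interior_nullSquare (r : ℝ) : interior (nullSquare r) =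
    nullCoordL.toHomeomorph ⁻¹' (Set.Ioo (-r) r ×ˢ Set.Ioo (-r) r) := by
  rw [nullSquare_eq_preimage, ← Homeomorph.preimage_interior, interior_prod_eq, interior_Icc]

theorem exists_int_add_mul_mem_Icc {r : ℝ} (hr : 0 < r) (x : ℝ) :
    ∃ n : ℤ, x + n * (2 * r) ∈ Set.Icc (-r) r := by
  obtain ⟨n, hn, -⟩ := existsUnique_add_zsmul_mem_Ico (mul_pos two_pos hr) x (-r)
  rw [zsmul_eq_mul] at hn
  exact ⟨n, hn.1, by linarith [hn.2]⟩

theorem eq_zero_of_mem_Ioo_of_add_mem_Ioo {r x : ℝ} {n : ℤ} (hx : x ∈ Set.Ioo (-r) r)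
    (hn : x + n * (2 * r) ∈ Set.Ioo (-r) r) : n = 0 := by
  have hr : 0 < r := by linarith [hx.1, hx.2]
  have h₁ : (n : ℝ) < 1 := by nlinarith [hx.1, hn.2]
  have h₂ : (-1 : ℝ) < n := by nlinarith [hx.2, hn.1]
  have h₁' : n < 1 := by exact_mod_cast h₁
  have h₂' : -1 < n := by exact_mod_cast h₂
  omega

theorem isFundamentalDomain_nullSquare {r : ℝ} (hr : 0 < r) :
    IsFundamentalDomain (nullLattice r) (nullSquare r) := by
  refine ⟨?_, fun z => ?_, fun w hw hw₀ z hz hzw => hw₀ ?_⟩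
  · rw [interior_nullSquare, ← Homeomorph.preimage_closure, closure_prod_eq,
      closure_Ioo (by linarith), nullSquare_eq_preimage]
  · obtain ⟨a, ha⟩ := exists_int_add_mul_mem_Icc hr (nullCoord z).1
    obtain ⟨b, hb⟩ := exists_int_add_mul_mem_Icc hr (nullCoord z).2
    refine ⟨nullCoord.symm (a * (2 * r), b * (2 * r)), ?_, ?_⟩
    · rw [mem_nullLattice, AlgEquiv.apply_symm_apply]
      exact ⟨⟨a, rfl⟩, b, rfl⟩
    · rw [nullSquare_eq_preimage]
      change nullCoord _ ∈ Set.Icc (-r) r ×ˢ Set.Icc (-r) r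
      rw [map_add, AlgEquiv.apply_symm_apply]
      exact ⟨ha, hb⟩
  · obtain ⟨⟨a, ha⟩, b, hb⟩ := mem_nullLattice.1 hw
    rw [interior_nullSquare] at hz hzw
    change nullCoord _ ∈ Set.Ioo (-r) r ×ˢ Set.Ioo (-r) r at hz hzw
    rw [map_add] at hzw
    obtain ⟨h₁, h₂⟩ := hzw
    rw [Prod.fst_add, ha] at h₁
    rw [Prod.snd_add, hb] at h₂
    apply nullCoord.injective
    rw [map_zero]
    ext
    · simp [ha, eq_zero_of_mem_Ioo_of_add_mem_Ioo hz.1 h₁]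
    · simp [hb, eq_zero_of_mem_Ioo_of_add_mem_Ioo hz.2 h₂]

/-! ### The elliptic integral and the amplitude. -/

theorem one_sub_mul_sin_sq_pos {m : ℝ} (hm : m < 1) (θ : ℝ) : 0 < 1 - m * Real.sin θ ^ 2 := by
  have h₀ := sq_nonneg (Real.sin θ)
  have h₁ := Real.sin_sq_le_one θ
  rcases le_or_gt m 0 with h | h <;> nlinarith

theorem continuous_ellipticF_integrand {m : ℝ} (hm : m < 1) :
    Continuous fun θ => 1 / √(1 - m * Real.sin θ ^ 2) := by
  refine continuous_const.div (by fun_prop) fun θ => ?_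
  exact (Real.sqrt_pos.2 (one_sub_mul_sin_sq_pos hm θ)).ne'

theorem hasDerivAt_ellipticF {m : ℝ} (hm : m < 1) (φ : ℝ) :
    HasDerivAt (ellipticF m) (1 / √(1 - m * Real.sin φ ^ 2)) φ :=
  ((continuous_ellipticF_integrand hm).integral_hasStrictDerivAt 0 φ).hasDerivAt

theorem deriv_ellipticF_pos {m : ℝ} (hm : m < 1) (φ : ℝ) :
    0 < 1 / √(1 - m * Real.sin φ ^ 2) :=
  one_div_pos.2 (Real.sqrt_pos.2 (one_sub_mul_sin_sq_pos hm φ))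

theorem strictMono_ellipticF {m : ℝ} (hm : m < 1) : StrictMono (ellipticF m) :=
  strictMono_of_deriv_pos fun φ => by
    rw [(hasDerivAt_ellipticF hm φ).deriv]
    exact deriv_ellipticF_pos hm φ

theorem ellipticF_zero (m : ℝ) : ellipticF m 0 = 0 := intervalIntegral.integral_same

theorem ellipticK_pos {m : ℝ} (hm : m < 1) : 0 < ellipticK m := by
  rw [← ellipticF_zero m]
  exact strictMono_ellipticF hm (by positivity)

/-- By `sin (π - φ) = sin φ`, the sum `F φ + F (π - φ)` is constant; compare `φ = 0` with `φ = π /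
2`. -/
theorem ellipticF_pi {m : ℝ} (hm : m < 1) : ellipticF m Real.pi = 2 * ellipticK m := by
  have hd (φ : ℝ) : HasDerivAt (fun φ => ellipticF m φ + ellipticF m (Real.pi - φ)) 0 φ := by
    have h := (hasDerivAt_ellipticF hm φ).fun_add
      ((hasDerivAt_ellipticF hm (Real.pi - φ)).comp_const_sub Real.pi φ)
    simpa [Real.sin_pi_sub] using h
  have h := is_const_of_deriv_eq_zero (fun φ => (hd φ).differentiableAt)
    (fun φ => (hd φ).deriv) 0 (Real.pi / 2)
  simp only [ellipticF_zero, sub_zero, zero_add, sub_half] at h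
  rw [h, ellipticK]
  ring

theorem ellipticF_add_pi {m : ℝ} (hm : m < 1) (φ : ℝ) :
    ellipticF m (φ + Real.pi) = ellipticF m φ + 2 * ellipticK m := by
  have hd (φ : ℝ) : HasDerivAt (fun φ => ellipticF m (φ + Real.pi) - ellipticF m φ) 0 φ := by
    have h := ((hasDerivAt_ellipticF hm (φ + Real.pi)).comp_add_const φ Real.pi).fun_sub
      (hasDerivAt_ellipticF hm φ)
    simpa [Real.sin_add_pi] using h
  have h := is_const_of_deriv_eq_zero (fun φ => (hd φ).differentiableAt)
    (fun φ => (hd φ).deriv) φ 0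
  simp only [ellipticF_zero, zero_add, sub_zero, ellipticF_pi hm] at h
  linarith

theorem ellipticF_add_int_mul_pi {m : ℝ} (hm : m < 1) (φ : ℝ) (n : ℤ) :
    ellipticF m (φ + n * Real.pi) = ellipticF m φ + n * (2 * ellipticK m) := by
  -- Subtracting the mean slope `2K / π` makes the integral periodic, so integer multiples of `π`
  -- come for free.
  have hp : Function.Periodic
      (fun φ => ellipticF m φ - 2 * ellipticK m / Real.pi * φ) Real.pi := by
    intro φ
    have := Real.pi_ne_zero
    simp only [ellipticF_add_pi hm]
    field_simp
    ring
  have h := hp.int_mul n φ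
  have h' : 2 * ellipticK m / Real.pi * (φ + n * Real.pi) =
      2 * ellipticK m / Real.pi * φ + n * (2 * ellipticK m) := by
    have := Real.pi_ne_zero
    field_simp
  simp only [h'] at h
  linarith

theorem surjective_ellipticF {m : ℝ} (hm : m < 1) : Function.Surjective (ellipticF m) := by
  intro x
  have hK := ellipticK_pos hm
  have hc : Continuous (ellipticF m) :=
    continuous_iff_continuousAt.2 fun φ => (hasDerivAt_ellipticF hm φ).continuousAt
  obtain ⟨n, hn⟩ := exists_int_gt (x / (2 * ellipticK m))
  obtain ⟨k, hk⟩ := exists_int_lt (x / (2 * ellipticK m))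
  rw [div_lt_iff₀ (by positivity)] at hn
  rw [lt_div_iff₀ (by positivity)] at hk
  have hF (n : ℤ) : ellipticF m (n * Real.pi) = n * (2 * ellipticK m) := by
    simpa [ellipticF_zero] using ellipticF_add_int_mul_pi hm 0 n
  exact mem_range_of_exists_le_of_exists_ge hc ⟨_, (hF k).trans_le hk.le⟩
    ⟨_, hn.le.trans_eq (hF n).symm⟩

theorem ellipticF_jacobiAm {m : ℝ} (hm : m < 1) (x : ℝ) : ellipticF m (jacobiAm m x) = x :=
  Function.rightInverse_invFun (surjective_ellipticF hm) x

theorem jacobiAm_ellipticF {m : ℝ} (hm : m < 1) (φ : ℝ) : jacobiAm m (ellipticF m φ) = φ :=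
  Function.leftInverse_invFun (strictMono_ellipticF hm).injective φ

theorem jacobiAm_add_int_mul {m : ℝ} (hm : m < 1) (x : ℝ) (n : ℤ) :
    jacobiAm m (x + n * (2 * ellipticK m)) = jacobiAm m x + n * Real.pi := by
  apply (strictMono_ellipticF hm).injective
  rw [ellipticF_jacobiAm hm, ellipticF_add_int_mul_pi hm, ellipticF_jacobiAm hm]

theorem jacobiAm_zero {m : ℝ} (hm : m < 1) : jacobiAm m 0 = 0 := by
  simpa only [ellipticF_zero] using jacobiAm_ellipticF hm 0

theorem jacobiAm_ellipticK {m : ℝ} (hm : m < 1) : jacobiAm m (ellipticK m) = Real.pi / 2 :=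
  jacobiAm_ellipticF hm _

theorem jacobiAm_eq_int_mul_pi_iff {m : ℝ} (hm : m < 1) {x : ℝ} {n : ℤ} :
    jacobiAm m x = n * Real.pi ↔ x = n * (2 * ellipticK m) := by
  have h := jacobiAm_add_int_mul hm 0 n
  rw [zero_add, jacobiAm_zero hm, zero_add] at h
  constructor
  · intro hx
    rw [← ellipticF_jacobiAm hm x, hx, ← h, ellipticF_jacobiAm hm]
  · rintro rfl
    exact h

/-- The integrand extends holomorphically to a disc about `φ`, since its radicand is positive at `φ`
and so stays in the slit plane nearby. A holomorphic primitive exists on the disc, and its real part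
on the real axis differs from `ellipticF m` by a constant. -/
theorem analyticAt_ellipticF {m : ℝ} (hm : m < 1) (φ : ℝ) : AnalyticAt ℝ (ellipticF m) φ := by
  let G : ℂ → ℂ := fun z => (1 - m * Complex.sin z ^ 2) ^ (-(1 / 2) : ℂ)
  have hre (x : ℝ) : 1 - (m : ℂ) * Complex.sin x ^ 2 = ((1 - m * Real.sin x ^ 2 : ℝ) : ℂ) := by
    push_cast
    rfl
  have hG (x : ℝ) : (G x).re = 1 / √(1 - m * Real.sin x ^ 2) := by
    simp only [G]
    rw [hre, show (-(1 / 2) : ℂ) = ((-(1 / 2) : ℝ) : ℂ) by push_cast; rfl,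
      ← Complex.ofReal_cpow (one_sub_mul_sin_sq_pos hm x).le, Complex.ofReal_re,
      Real.rpow_neg (one_sub_mul_sin_sq_pos hm x).le, Real.sqrt_eq_rpow, one_div, one_div]
  have hopen : IsOpen {z : ℂ | 1 - m * Complex.sin z ^ 2 ∈ Complex.slitPlane} :=
    Complex.isOpen_slitPlane.preimage (by fun_prop)
  obtain ⟨r, hr, hball⟩ := Metric.isOpen_iff.1 hopen φ (by
    simp only [Set.mem_ofPred_eq]
    rw [hre]
    exact Complex.ofReal_mem_slitPlane.2 (one_sub_mul_sin_sq_pos hm φ))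
  have hGd : DifferentiableOn ℂ G (Metric.ball (φ : ℂ) r) := fun z hz =>
    (DifferentiableAt.cpow (f := fun z => 1 - m * Complex.sin z ^ 2) (by fun_prop) (by fun_prop)
      (hball hz)).differentiableWithinAt
  obtain ⟨H, hH⟩ := hGd.isExactOn_ball
  have hHd : DifferentiableOn ℂ H (Metric.ball (φ : ℂ) r) := fun z hz =>
    (hH z hz).differentiableAt.differentiableWithinAt
  have hHa : AnalyticAt ℝ (fun x : ℝ => (H x).re) φ :=
    (hHd.analyticAt (Metric.ball_mem_nhds _ hr)).re_ofReal
  have hd : ∀ x ∈ Metric.ball φ r, HasDerivAt (fun x => ellipticF m x - (H x).re) 0 x := by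
    intro x hx
    have hx' : (x : ℂ) ∈ Metric.ball (φ : ℂ) r := by
      rw [Metric.mem_ball, Complex.dist_of_im_eq (by simp)]
      simpa using hx
    have h := (hasDerivAt_ellipticF hm x).sub (hH x hx').real_of_complex
    rwa [hG, sub_self] at h
  have hconst : ∀ x ∈ Metric.ball φ r,
      ellipticF m x - (H x).re = ellipticF m φ - (H φ).re := fun x hx =>
    Metric.isOpen_ball.is_const_of_deriv_eq_zero (convex_ball φ r).isPreconnected
      (fun y hy => (hd y hy).differentiableAt.differentiableWithinAt)
      (fun y hy => (hd y hy).deriv) hx (Metric.mem_ball_self hr)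
  refine (hHa.add (analyticAt_const (v := ellipticF m φ - (H φ).re))).congr ?_
  filter_upwards [Metric.ball_mem_nhds φ hr] with x hx
  simp only [Pi.add_apply]
  linarith [hconst x hx]

/-- The composite with `ellipticF m` is the identity, and analyticity descends through an analytic
map with nonzero derivative. -/
theorem analyticAt_jacobiAm {m : ℝ} (hm : m < 1) (x : ℝ) : AnalyticAt ℝ (jacobiAm m) x := by
  rw [← ellipticF_jacobiAm hm x, ← analyticAt_comp_iff_of_deriv_ne_zero
    (analyticAt_ellipticF hm _)]
  · rw [show jacobiAm m ∘ ellipticF m = id from funext (jacobiAm_ellipticF hm)]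
    exact analyticAt_id
  · rw [(hasDerivAt_ellipticF hm _).deriv]
    exact (deriv_ellipticF_pos hm _).ne'

theorem hasDerivAt_jacobiAm {m : ℝ} (hm : m < 1) (x : ℝ) :
    HasDerivAt (jacobiAm m) (√(1 - m * Real.sin (jacobiAm m x) ^ 2)) x := by
  have h := HasDerivAt.of_local_left_inverse (analyticAt_jacobiAm hm x).continuousAt
    (hasDerivAt_ellipticF hm _) (deriv_ellipticF_pos hm _).ne'
    (Eventually.of_forall (ellipticF_jacobiAm hm))
  simpa using h

/-! ### Analyticity and differential equations of the real functions. -/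

theorem jacobiSn_of_lt_one {m : ℝ} (hm : m < 1) :
    jacobiSn m = fun x => Real.sin (jacobiAm m x) := by
  funext x; simp [jacobiSn, hm]

theorem jacobiCn_of_lt_one {m : ℝ} (hm : m < 1) :
    jacobiCn m = fun x => Real.cos (jacobiAm m x) := by
  funext x; simp [jacobiCn, hm]

theorem jacobiDn_of_lt_one {m : ℝ} (hm : m < 1) :
    jacobiDn m = fun x => √(1 - m * Real.sin (jacobiAm m x) ^ 2) := by
  funext x; simp [jacobiDn, hm]

theorem jacobiSn_of_one_lt {m : ℝ} (hm : 1 < m) :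
    jacobiSn m = fun x => jacobiSn m⁻¹ (√m * x) / √m := by
  funext x; simp [jacobiSn, hm.not_gt, inv_lt_one_of_one_lt₀ hm]

theorem jacobiCn_of_one_lt {m : ℝ} (hm : 1 < m) :
    jacobiCn m = fun x => jacobiDn m⁻¹ (√m * x) := by
  funext x; simp [jacobiCn, jacobiDn, hm.not_gt, inv_lt_one_of_one_lt₀ hm]

theorem jacobiDn_of_one_lt {m : ℝ} (hm : 1 < m) :
    jacobiDn m = fun x => jacobiCn m⁻¹ (√m * x) := by
  funext x; simp [jacobiCn, jacobiDn, hm.not_gt, inv_lt_one_of_one_lt₀ hm]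

theorem jacobiCn_sq {m : ℝ} (hm : m < 1) (x : ℝ) : jacobiCn m x ^ 2 = 1 - jacobiSn m x ^ 2 := by
  simp only [jacobiCn_of_lt_one hm, jacobiSn_of_lt_one hm, Real.cos_sq']

theorem jacobiDn_sq {m : ℝ} (hm : m < 1) (x : ℝ) :
    jacobiDn m x ^ 2 = 1 - m * jacobiSn m x ^ 2 := by
  simp only [jacobiDn_of_lt_one hm, jacobiSn_of_lt_one hm,
    Real.sq_sqrt (one_sub_mul_sin_sq_pos hm _).le]

theorem hasDerivAt_jacobiSn {m : ℝ} (hm : m < 1) (x : ℝ) :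
    HasDerivAt (jacobiSn m) (jacobiCn m x * jacobiDn m x) x := by
  rw [jacobiSn_of_lt_one hm, jacobiCn_of_lt_one hm, jacobiDn_of_lt_one hm]
  exact (hasDerivAt_jacobiAm hm x).sin

theorem hasDerivAt_jacobiCn {m : ℝ} (hm : m < 1) (x : ℝ) :
    HasDerivAt (jacobiCn m) (-jacobiSn m x * jacobiDn m x) x := by
  rw [jacobiSn_of_lt_one hm, jacobiCn_of_lt_one hm, jacobiDn_of_lt_one hm]
  exact (hasDerivAt_jacobiAm hm x).cos

theorem hasDerivAt_jacobiDn {m : ℝ} (hm : m < 1) (x : ℝ) :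
    HasDerivAt (jacobiDn m) (-m * jacobiSn m x * jacobiCn m x) x := by
  have h := (((hasDerivAt_jacobiAm hm x).sin.fun_pow 2).const_mul m).const_sub 1 |>.sqrt
    (one_sub_mul_sin_sq_pos hm _).ne'
  have hs := (Real.sqrt_pos.2 (one_sub_mul_sin_sq_pos hm (jacobiAm m x))).ne'
  rw [jacobiSn_of_lt_one hm, jacobiCn_of_lt_one hm, jacobiDn_of_lt_one hm]
  convert h using 1
  field_simp
  ring

theorem analyticAt_jacobiSn_of_lt_one {m : ℝ} (hm : m < 1) (x : ℝ) :
    AnalyticAt ℝ (jacobiSn m) x := by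
  rw [jacobiSn_of_lt_one hm]
  exact Real.analyticAt_sin.comp (analyticAt_jacobiAm hm x)

theorem analyticAt_jacobiCn_of_lt_one {m : ℝ} (hm : m < 1) (x : ℝ) :
    AnalyticAt ℝ (jacobiCn m) x := by
  rw [jacobiCn_of_lt_one hm]
  exact Real.analyticAt_cos.comp (analyticAt_jacobiAm hm x)

theorem analyticAt_jacobiDn_of_lt_one {m : ℝ} (hm : m < 1) (x : ℝ) :
    AnalyticAt ℝ (jacobiDn m) x := by
  have h := analyticAt_jacobiSn_of_lt_one hm x
  have hpos := one_sub_mul_sin_sq_pos hm (jacobiAm m x)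
  rw [jacobiSn_of_lt_one hm] at h
  rw [jacobiDn_of_lt_one hm]
  exact (Real.contDiffAt_sqrt hpos.ne').analyticAt.comp
    (g := fun x => √x) (f := fun x => 1 - m * Real.sin (jacobiAm m x) ^ 2)
    (analyticAt_const.sub (analyticAt_const.mul (h.pow 2)))

theorem analyticAt_comp_const_mul {y : ℝ → ℝ} (hy : ∀ x, AnalyticAt ℝ y x) (c x : ℝ) :
    AnalyticAt ℝ (fun x => y (c * x)) x :=
  (hy (c * x)).comp (g := y) (f := fun x => c * x) (analyticAt_const.mul analyticAt_id)

theorem analyticAt_jacobiSn {m : ℝ} (hm : m ≠ 1) (x : ℝ) : AnalyticAt ℝ (jacobiSn m) x := by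
  rcases hm.lt_or_gt with h | h
  · exact analyticAt_jacobiSn_of_lt_one h x
  · rw [jacobiSn_of_one_lt h]
    exact (analyticAt_comp_const_mul
      (analyticAt_jacobiSn_of_lt_one (inv_lt_one_of_one_lt₀ h)) _ x).div_const

theorem analyticAt_jacobiCn {m : ℝ} (hm : m ≠ 1) (x : ℝ) : AnalyticAt ℝ (jacobiCn m) x := by
  rcases hm.lt_or_gt with h | h
  · exact analyticAt_jacobiCn_of_lt_one h x
  · rw [jacobiCn_of_one_lt h]
    exact analyticAt_comp_const_mul
      (analyticAt_jacobiDn_of_lt_one (inv_lt_one_of_one_lt₀ h)) _ x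

theorem analyticAt_jacobiDn {m : ℝ} (hm : m ≠ 1) (x : ℝ) : AnalyticAt ℝ (jacobiDn m) x := by
  rcases hm.lt_or_gt with h | h
  · exact analyticAt_jacobiDn_of_lt_one h x
  · rw [jacobiDn_of_one_lt h]
    exact analyticAt_comp_const_mul
      (analyticAt_jacobiCn_of_lt_one (inv_lt_one_of_one_lt₀ h)) _ x

theorem hasDerivAt_comp_const_mul {y : ℝ → ℝ} {c d x : ℝ} (hy : HasDerivAt y d (c * x)) :
    HasDerivAt (fun x => y (c * x)) (d * c) x := by
  simpa [Function.comp_def] using hy.comp x ((hasDerivAt_id x).const_mul c)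

theorem exists_hasDerivAt_jacobiSn {m : ℝ} (hm : m ≠ 1) (x : ℝ) :
    ∃ d, HasDerivAt (jacobiSn m) d x ∧
      d ^ 2 = (1 - jacobiSn m x ^ 2) * (1 - m * jacobiSn m x ^ 2) := by
  rcases hm.lt_or_gt with h | h
  · exact ⟨_, hasDerivAt_jacobiSn h x, by rw [mul_pow, jacobiCn_sq h, jacobiDn_sq h]⟩
  · have h' := inv_lt_one_of_one_lt₀ h
    have hs : √m ≠ 0 := (Real.sqrt_pos.2 (by linarith)).ne'
    have hm' : √m ^ 2 = m := Real.sq_sqrt (by linarith)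
    rw [jacobiSn_of_one_lt h]
    refine ⟨_, (hasDerivAt_comp_const_mul (hasDerivAt_jacobiSn h' _)).div_const _, ?_⟩
    -- The chain-rule factor `√m` cancels the prefactor `1 / √m`.
    rw [mul_div_assoc, div_self hs, mul_one, mul_pow, jacobiCn_sq h', jacobiDn_sq h', div_pow,
      hm']
    field_simp

theorem exists_hasDerivAt_jacobiCn {m : ℝ} (hm : m ≠ 1) (x : ℝ) :
    ∃ d, HasDerivAt (jacobiCn m) d x ∧
      d ^ 2 = (1 - jacobiCn m x ^ 2) * (1 - m + m * jacobiCn m x ^ 2) := by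
  rcases hm.lt_or_gt with h | h
  · refine ⟨_, hasDerivAt_jacobiCn h x, ?_⟩
    rw [mul_pow, jacobiCn_sq h, jacobiDn_sq h]
    ring
  · have h' := inv_lt_one_of_one_lt₀ h
    have hm' : √m ^ 2 = m := Real.sq_sqrt (by linarith)
    have h₀ : m ≠ 0 := by linarith
    rw [jacobiCn_of_one_lt h]
    refine ⟨_, hasDerivAt_comp_const_mul (hasDerivAt_jacobiDn h' _), ?_⟩
    simp only [mul_pow, jacobiCn_sq h', jacobiDn_sq h', hm']
    field_simp
    ring

theorem exists_hasDerivAt_jacobiDn {m : ℝ} (hm : m ≠ 1) (x : ℝ) :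
    ∃ d, HasDerivAt (jacobiDn m) d x ∧
      d ^ 2 = (jacobiDn m x ^ 2 - 1) * (1 - m - jacobiDn m x ^ 2) := by
  rcases hm.lt_or_gt with h | h
  · refine ⟨_, hasDerivAt_jacobiDn h x, ?_⟩
    simp only [mul_pow, jacobiCn_sq h, jacobiDn_sq h]
    ring
  · have h' := inv_lt_one_of_one_lt₀ h
    have hm' : √m ^ 2 = m := Real.sq_sqrt (by linarith)
    have h₀ : m ≠ 0 := by linarith
    rw [jacobiDn_of_one_lt h]
    refine ⟨_, hasDerivAt_comp_const_mul (hasDerivAt_jacobiCn h' _), ?_⟩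
    simp only [mul_pow, jacobiCn_sq h', jacobiDn_sq h', hm']
    field_simp
    ring

/-! ### Period groups of the real functions. -/

theorem periodic_jacobiSn_iff {m : ℝ} (hm : m < 1) (c : ℝ) :
    Function.Periodic (jacobiSn m) c ↔ ∃ n : ℤ, c = n * (2 * (2 * ellipticK m)) := by
  rw [jacobiSn_of_lt_one hm]
  constructor
  · intro h
    have h₀ : Real.sin (jacobiAm m c) = 0 := by simpa [jacobiAm_zero hm] using h 0
    obtain ⟨n, hn⟩ := Real.sin_eq_zero_iff.1 h₀
    obtain rfl := (jacobiAm_eq_int_mul_pi_iff hm).1 hn.symm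
    -- The zeros of `sn` only give multiples of `2K`. Testing at `K`, where `sn` is `1`, forces
    -- `(-1) ^ n = 1` and excludes the odd ones.
    have h₁ := h (ellipticK m)
    simp only [jacobiAm_add_int_mul hm, jacobiAm_ellipticK hm, Real.sin_add_int_mul_pi,
      Real.sin_pi_div_two, mul_one] at h₁
    rcases Int.even_or_odd n with he | ho
    · obtain ⟨k, rfl⟩ := he
      exact ⟨k, by push_cast; ring⟩
    · rw [ho.neg_one_zpow] at h₁
      norm_num at h₁
  · rintro ⟨n, rfl⟩ x
    have h := jacobiAm_add_int_mul hm x (n * 2)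
    push_cast at h
    rw [mul_assoc (n : ℝ), mul_assoc (n : ℝ)] at h
    simp only [h, Real.sin_add_int_mul_two_pi]

theorem periodic_jacobiCn_iff {m : ℝ} (hm : m < 1) (c : ℝ) :
    Function.Periodic (jacobiCn m) c ↔ ∃ n : ℤ, c = n * (2 * (2 * ellipticK m)) := by
  rw [jacobiCn_of_lt_one hm]
  constructor
  · intro h
    -- The value `1` at `0` recurs only when the amplitude is a multiple of `2π`, so one test point
    -- suffices.
    have h₀ : Real.cos (jacobiAm m c) = 1 := by simpa [jacobiAm_zero hm] using h 0
    obtain ⟨n, hn⟩ := (Real.cos_eq_one_iff _).1 h₀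
    have h₁ : jacobiAm m c = (n * 2 : ℤ) * Real.pi := by rw [← hn]; push_cast; ring
    refine ⟨n, ?_⟩
    rw [(jacobiAm_eq_int_mul_pi_iff hm).1 h₁]
    push_cast
    ring
  · rintro ⟨n, rfl⟩ x
    have h := jacobiAm_add_int_mul hm x (n * 2)
    push_cast at h
    rw [mul_assoc (n : ℝ), mul_assoc (n : ℝ)] at h
    simp only [h, Real.cos_add_int_mul_two_pi]

/-- Only the square of `sn` enters `dn`, so the sign change of `sn` under `2K` is invisible and the
period halves. For `m = 0` the function would be constant. -/
theorem periodic_jacobiDn_iff {m : ℝ} (hm₀ : m ≠ 0) (hm : m < 1) (c : ℝ) :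
    Function.Periodic (jacobiDn m) c ↔ ∃ n : ℤ, c = n * (2 * ellipticK m) := by
  constructor
  · intro h
    have h₀ : jacobiSn m 0 = 0 := by simp [jacobiSn_of_lt_one hm, jacobiAm_zero hm]
    have h₁ : jacobiDn m c ^ 2 = jacobiDn m 0 ^ 2 := by rw [← h 0, zero_add]
    rw [jacobiDn_sq hm, jacobiDn_sq hm, h₀] at h₁
    have h₂ : jacobiSn m c = 0 := by simpa [hm₀] using h₁
    rw [jacobiSn_of_lt_one hm] at h₂
    obtain ⟨n, hn⟩ := Real.sin_eq_zero_iff.1 h₂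
    exact ⟨n, (jacobiAm_eq_int_mul_pi_iff hm).1 hn.symm⟩
  · rintro ⟨n, rfl⟩ x
    have h : ((-1 : ℝ) ^ n) ^ 2 = 1 := by
      rcases Int.even_or_odd n with h | h <;> simp [h.neg_one_zpow]
    simp only [jacobiDn_of_lt_one hm, jacobiAm_add_int_mul hm, Real.sin_add_int_mul_pi, mul_pow,
      h, one_mul]

theorem periodic_comp_const_mul_iff {y : ℝ → ℝ} {a r : ℝ} (ha : a ≠ 0)
    (hy : ∀ c, Function.Periodic y c ↔ ∃ n : ℤ, c = n * r) (c : ℝ) :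
    Function.Periodic (fun x => y (a * x)) c ↔ ∃ n : ℤ, c = n * (r / a) := by
  have h : Function.Periodic (fun x => y (a * x)) c ↔ Function.Periodic y (a * c) := by
    refine ⟨fun h x => ?_, fun h x => ?_⟩
    · simpa [mul_add, mul_div_cancel₀ _ ha] using h (x / a)
    · simpa [mul_add] using h (a * x)
  rw [h, hy]
  refine exists_congr fun n => ?_
  rw [← mul_div_assoc, eq_div_iff ha, mul_comm a]

theorem periodic_jacobiSn_of_one_lt_iff {m : ℝ} (hm : 1 < m) (c : ℝ) :
    Function.Periodic (jacobiSn m) c ↔ ∃ n : ℤ, c = n * (2 * (2 * (ellipticK m⁻¹ / √m))) := by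
  have hs : √m ≠ 0 := (Real.sqrt_pos.2 (by linarith)).ne'
  have h : Function.Periodic (jacobiSn m) c ↔
      Function.Periodic (fun x => jacobiSn m⁻¹ (√m * x)) c := by
    rw [jacobiSn_of_one_lt hm]
    exact forall_congr' fun x => div_left_inj' hs
  rw [h, periodic_comp_const_mul_iff hs (periodic_jacobiSn_iff (inv_lt_one_of_one_lt₀ hm))]
  simp only [mul_div_assoc]

theorem periodic_jacobiCn_of_one_lt_iff {m : ℝ} (hm : 1 < m) (c : ℝ) :
    Function.Periodic (jacobiCn m) c ↔ ∃ n : ℤ, c = n * (2 * (ellipticK m⁻¹ / √m)) := by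
  have hs : √m ≠ 0 := (Real.sqrt_pos.2 (by linarith)).ne'
  rw [jacobiCn_of_one_lt hm, periodic_comp_const_mul_iff hs (periodic_jacobiDn_iff
    (inv_ne_zero (by linarith)) (inv_lt_one_of_one_lt₀ hm))]
  simp only [mul_div_assoc]

theorem periodic_jacobiDn_of_one_lt_iff {m : ℝ} (hm : 1 < m) (c : ℝ) :
    Function.Periodic (jacobiDn m) c ↔ ∃ n : ℤ, c = n * (2 * (2 * (ellipticK m⁻¹ / √m))) := by
  have hs : √m ≠ 0 := (Real.sqrt_pos.2 (by linarith)).ne'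
  rw [jacobiDn_of_one_lt hm,
    periodic_comp_const_mul_iff hs (periodic_jacobiCn_iff (inv_lt_one_of_one_lt₀ hm))]
  simp only [mul_div_assoc]

end LJacobi

open LJacobi
theorem mainTheorem11 (m : ℝ) (hm₀ : m ≠ 0) (hm₁ : m ≠ 1) :
    ∃ SN CN DN : LJacobi.Lorentz → LJacobi.Lorentz,
      -- the unique Lorentz-analytic extensions of the real functions
      LJacobi.IsUniqueLAnalyticExtension (LJacobi.jacobiSn m) SN ∧
      LJacobi.IsUniqueLAnalyticExtension (LJacobi.jacobiCn m) CN ∧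
      LJacobi.IsUniqueLAnalyticExtension (LJacobi.jacobiDn m) DN ∧
      -- the elliptic differential equations
      (∀ z, ∃ d, LJacobi.HasLDerivAt SN d z ∧
        d ^ 2 = (1 - SN z ^ 2) * (1 - m • SN z ^ 2)) ∧
      (∀ z, ∃ d, LJacobi.HasLDerivAt CN d z ∧
        d ^ 2 = (1 - CN z ^ 2) * (algebraMap ℝ LJacobi.Lorentz (1 - m) + m • CN z ^ 2)) ∧
      (∀ z, ∃ d, LJacobi.HasLDerivAt DN d z ∧
        d ^ 2 = (DN z ^ 2 - 1) * (algebraMap ℝ LJacobi.Lorentz (1 - m) - DN z ^ 2)) ∧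
      -- double periodicity for a modulus in (0, 1) or an imaginary modulus
      (m < 1 → ∀ K : ℝ, K = LJacobi.ellipticK m →
        LJacobi.HasPeriodLattice SN (LJacobi.nullPlus (2 * K)) (LJacobi.nullMinus (2 * K)) ∧
        LJacobi.HasPeriodLattice CN (LJacobi.nullPlus (2 * K)) (LJacobi.nullMinus (2 * K)) ∧
        LJacobi.HasPeriodLattice DN (LJacobi.nullPlus K) (LJacobi.nullMinus K) ∧
        LJacobi.nullLattice (2 * K) ≤ LJacobi.periods DN ∧
        LJacobi.IsFundamentalDomain (LJacobi.nullLattice (2 * K)) (LJacobi.nullSquare (2 * K)) ∧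
        LJacobi.IsFundamentalDomain (LJacobi.nullLattice K) (LJacobi.nullSquare K)) ∧
      -- double periodicity for a modulus greater than 1
      (1 < m → ∀ K : ℝ, K = LJacobi.ellipticK m⁻¹ / √m →
        LJacobi.HasPeriodLattice SN (LJacobi.nullPlus (2 * K)) (LJacobi.nullMinus (2 * K)) ∧
        LJacobi.HasPeriodLattice DN (LJacobi.nullPlus (2 * K)) (LJacobi.nullMinus (2 * K)) ∧
        LJacobi.HasPeriodLattice CN (LJacobi.nullPlus K) (LJacobi.nullMinus K) ∧
        LJacobi.nullLattice (2 * K) ≤ LJacobi.periods CN ∧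
        LJacobi.IsFundamentalDomain (LJacobi.nullLattice (2 * K)) (LJacobi.nullSquare (2 * K)) ∧
        LJacobi.IsFundamentalDomain (LJacobi.nullLattice K) (LJacobi.nullSquare K)) := by
  refine ⟨nullExtension (jacobiSn m), nullExtension (jacobiCn m), nullExtension (jacobiDn m),
    isUniqueLAnalyticExtension_nullExtension (analyticAt_jacobiSn hm₁),
    isUniqueLAnalyticExtension_nullExtension (analyticAt_jacobiCn hm₁),
    isUniqueLAnalyticExtension_nullExtension (analyticAt_jacobiDn hm₁),
    exists_hasLDerivAt_nullExtension (P := fun s => (1 - s ^ 2) * (1 - m * s ^ 2))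
      (Q := fun s => (1 - s ^ 2) * (1 - m • s ^ 2)) (fun z => ?_)
      (exists_hasDerivAt_jacobiSn hm₁),
    exists_hasLDerivAt_nullExtension (P := fun c => (1 - c ^ 2) * (1 - m + m * c ^ 2))
      (Q := fun c => (1 - c ^ 2) * (algebraMap ℝ Lorentz (1 - m) + m • c ^ 2)) (fun z => ?_)
      (exists_hasDerivAt_jacobiCn hm₁),
    exists_hasLDerivAt_nullExtension (P := fun d => (d ^ 2 - 1) * (1 - m - d ^ 2))
      (Q := fun d => (d ^ 2 - 1) * (algebraMap ℝ Lorentz (1 - m) - d ^ 2)) (fun z => ?_)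
      (exists_hasDerivAt_jacobiDn hm₁),
    ?_, ?_⟩
  -- `nullCoord` is an algebra map, so the polynomial on the right-hand side acts coordinatewise.
  · simp only [map_mul, map_sub, map_one, map_pow, map_smul]
    rfl
  · simp only [map_mul, map_sub, map_add, map_one, map_pow, map_smul, AlgEquiv.commutes]
    rfl
  · simp only [map_mul, map_sub, map_one, map_pow, AlgEquiv.commutes]
    rfl
  · rintro hm K rfl
    have hK := ellipticK_pos hm
    have hK₂ : 0 < 2 * ellipticK m := by positivity
    have hD := periodic_jacobiDn_iff hm₀ hm
    exact ⟨hasPeriodLattice_nullExtension hK₂.ne' (periodic_jacobiSn_iff hm),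
      hasPeriodLattice_nullExtension hK₂.ne' (periodic_jacobiCn_iff hm),
      hasPeriodLattice_nullExtension hK.ne' hD,
      (nullLattice_two_mul_le _).trans_eq (periods_nullExtension hD).symm,
      isFundamentalDomain_nullSquare hK₂, isFundamentalDomain_nullSquare hK⟩
  · rintro hm K rfl
    have hK : 0 < ellipticK m⁻¹ / √m :=
      div_pos (ellipticK_pos (inv_lt_one_of_one_lt₀ hm)) (Real.sqrt_pos.2 (by linarith))
    have hK₂ : 0 < 2 * (ellipticK m⁻¹ / √m) := by positivity
    have hC := periodic_jacobiCn_of_one_lt_iff hm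
    exact ⟨hasPeriodLattice_nullExtension hK₂.ne' (periodic_jacobiSn_of_one_lt_iff hm),
      hasPeriodLattice_nullExtension hK₂.ne' (periodic_jacobiDn_of_one_lt_iff hm),
      hasPeriodLattice_nullExtension hK.ne' hC,
      (nullLattice_two_mul_le _).trans_eq (periods_nullExtension hC).symm,
      isFundamentalDomain_nullSquare hK₂, isFundamentalDomain_nullSquare hK⟩
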